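/- Consider the infinite system $$\dot a_n(t)=(n-1)a_{n-1}(t)-n\,a_{n+1}(t),\qquad n=1,2,\dots,\quad a_0\equiv 0,\tag{B}$$ for real $a_n$. A solution for all time means differentiable functions $a_n:[0,\infty)\to\mathbb R$ satisfying (B) for all $t\ge 0$ whose generating functions $\sum_{n\ge0}a_{n+1}(t)z^n$ are analytic near $z=0$ locally uniformly in time, i.e. for every $T$ there are $C,\gamma$ with $|a_n(t)|\le C\gamma^n$ for all $n\ge1$, $t\in[0,T]$. **Theorem.** Let $(a_n(t))$ be a solution for all time which converges coordinatewise as $t\to\infty$ to a vector $(\bar a_1,\bar a_2,\dots)$ that is not the zero vector. Then $G_0(z)=\sum_{n\ge 0}a_{n+1}(0)z^n$ continues analytically to a neighborhood of $(-1,0]$. Denote the continuation again by $G_0$. 1. Suppose that $G_0$ has only a power-like singularity at $z=-1$: for some $A,\alpha\in\mathbb R$, the function $G_0(x)-A(1+x)^{-\alpha}$ has a finite limit as $x\to-1$ from the right along the real axis. Then $A\ne0$, $\alpha=\tfrac12$, and $$G_0(z)=\frac{A}{(1+z)^{1/2}}+\tilde G_0(z)$$ in a neighborhood of $(-1,0]$,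 where $\tilde G_0$ is analytic in a neighborhood of $(-1,0]$ and $\tilde G_0(x)$ has a finite limit as $x\to-1$ from the right along the real axis. Moreover $$\sum_{n=0}^\infty \bar a_{n+1}z^n=A\sqrt{\frac{2}{1-z^2}}\qquad(|z|<1).\tag{F}$$ 2. If one assumes only that $G_0(x)\sim A(1+x)^{-\alpha}$ as $x\to-1$ from the right along the real axis, for some real $A\neq0$ and $\alpha>0$, then still $\alpha=\tfrac12$ and (F) holds. 3. A real sequence $(b_1,b_2,\dots)$ is a fixed point of (B), that is $(n-1)b_{n-1}-n\,b_{n+1}=0$ for all $n\ge1$ (with $b_0=0$), if and only if there is $A\in\mathbb R$ with $\sum_{n\ge0}b_{n+1}z^n=A\sqrt{2/(1-z^2)}$ for $|z|<1$. Powers and square roots are principal branches. -/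

import Mathlib

open Filter Topology Set

namespace ShellModel

/-- The right-hand side `(n-1) b_{n-1} - n b_{n+1}` of the shell model, in coordinate `n ≥ 1`. -/
def field (b : ℕ → ℝ) (n : ℕ) : ℝ :=
  ((n : ℝ) - 1) * b (n - 1) - (n : ℝ) * b (n + 1)

/-- A solution on `[0, ∞)` of `a_n' = (n-1) a_{n-1} - n a_{n+1}`, `n ≥ 1`, with `a_0 = 0`.
The growth condition says that the generating functions `∑ a_{n+1}(t) z^n` are analytic near the
origin, locally uniformly in time.  It is what makes the initial value problem well posed: without
it every smooth function `a_1` of time can be completed to a solution of the equations. -/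
structure IsGlobalSolution (a : ℕ → ℝ → ℝ) : Prop where
  boundary : ∀ t : ℝ, 0 ≤ t → a 0 t = 0
  equation : ∀ n : ℕ, 1 ≤ n → ∀ t : ℝ, 0 ≤ t →
    HasDerivWithinAt (a n) (field (fun k => a k t) n) (Ici 0) t
  growth : ∀ T : ℝ, 0 ≤ T → ∃ C γ : ℝ, ∀ n : ℕ, 1 ≤ n → ∀ t ∈ Icc 0 T, |a n t| ≤ C * γ ^ n

/-- A fixed point: a vector at which the right-hand side vanishes in every coordinate. -/
def IsFixedPoint (b : ℕ → ℝ) : Prop :=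
  ∀ n : ℕ, 1 ≤ n → field b n = 0

/-- The real half-open interval `(-1, 0]`, inside `ℂ`. -/
def negInterval : Set ℂ := (fun x : ℝ => (x : ℂ)) '' Ioc (-1) 0

/-- `G` is the generating function `∑ b_{n+1} z^n`, summed near the origin and continued
analytically to a neighbourhood of `(-1, 0]`. -/
def IsGeneratingFunction (b : ℕ → ℝ) (G : ℂ → ℂ) : Prop :=
  AnalyticOnNhd ℂ G negInterval ∧
    ∀ᶠ z in 𝓝 (0 : ℂ), HasSum (fun n : ℕ => (b (n + 1) : ℂ) * z ^ n) (G z)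

/-- `F` has a finite limit at `-1` from the right along the real axis. -/
def HasFiniteLimit (F : ℂ → ℂ) : Prop :=
  ∃ c : ℝ, Tendsto (fun x : ℝ => F (x : ℂ)) (𝓝[>] (-1 : ℝ)) (𝓝 (c : ℂ))

/-- `∑ b_{n+1} z^n = A √(2 / (1 - z²))` on the open unit disk, with the principal square root
(note that `1 - z²` has positive real part there). -/
def HasFixedPointForm (b : ℕ → ℝ) (A : ℝ) : Prop :=
  ∀ z : ℂ, ‖z‖ < 1 →
    HasSum (fun n : ℕ => (b (n + 1) : ℂ) * z ^ n)
      ((A : ℂ) * (2 / (1 - z ^ 2)) ^ (1 / 2 : ℂ))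

end ShellModel

namespace ShellModel

/-! The generating function G(t,z) = ∑ a_{n+1}(t) z^n formally solves the transport equation G_t =
(z² - 1) G_z + z G. Its characteristic starting at -tanh t reaches 0 at time t, which gives G₀(-tanh
t) = a₁(t) cosh t, that is, √(1 - x²) G₀(x) = a₁(artanh(-x)) on (-1, 0]
(`IsGeneratingFunction.mul_sqrt`). Convergence of a₁ is thus a statement about G₀ at -1: √(1 + x)
G₀(x) tends to ā₁/√2 (`tendsto_mul_sqrt_one_add`). The limit vector is a fixed point, and fixed
points are the multiples of the Taylor coefficients of (1 - z²)^(-1/2); a nonzero limit therefore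
has ā₁ ≠ 0, and comparing powers of 1 + x forces α = 1/2 and A = ā₁/√2 (`eq_of_tendsto_mul_rpow`).

The identity is made rigorous by pairing the solution with an explicit solution of the adjoint
system (`tendsto_pairing`). This works only over short times, limited by the radius of convergence.
Since the growth constants are uniform on bounded time intervals, restarting at later times s yields
local analytic functions (`chart`) that take the same values on the real axis; they glue to the
continuation of G₀ (`exists_analytic_glue`). -/

/-! ### Fixed points and the Taylor series of (1 - z²)^(-1/2). -/

theorem ring_choose_succ_mul (a : ℝ) (k : ℕ) :
    ((k : ℝ) + 1) * Ring.choose a (k + 1) = (a - k) * Ring.choose a k := by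
  rw [Ring.choose_eq_smul, Ring.choose_eq_smul, descPochhammer_succ_right, Polynomial.smeval_mul,
    Nat.factorial_succ]
  have h1 : ((k : ℝ) + 1) ≠ 0 := by positivity
  have h2 : (k.factorial : ℝ) ≠ 0 := by positivity
  simp [Polynomial.smeval_natCast]
  field_simp

/-- The Taylor coefficients of `(1 - z²)^(-1/2)`. -/
noncomputable def profile (n : ℕ) : ℝ :=
  if Even n then (-1) ^ (n / 2) * Ring.choose (-1 / 2 : ℝ) (n / 2) else 0

theorem profile_zero : profile 0 = 1 := by simp [profile]

theorem profile_one : profile 1 = 0 := by simp [profile]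

theorem profile_add_two (n : ℕ) :
    ((n : ℝ) + 2) * profile (n + 2) = ((n : ℝ) + 1) * profile n := by
  by_cases h : Even n
  · obtain ⟨k, rfl⟩ := h
    have h1 : (k + k) / 2 = k := by omega
    have h2 : (k + k + 2) / 2 = k + 1 := by omega
    have h3 : Even (k + k + 2) := ⟨k + 1, by ring⟩
    have h4 : Even (k + k) := ⟨k, rfl⟩
    simp only [profile, h3, h4, if_true, h1, h2]
    have := ring_choose_succ_mul (-1 / 2) k
    push_cast
    rw [pow_succ]
    linear_combination (-2 * (-1) ^ k) * this
  · have h3 : ¬ Even (n + 2) := by rwa [Nat.even_add, iff_true_right even_two]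
    simp [profile, h, h3]

theorem field_add_two (b : ℕ → ℝ) (m : ℕ) :
    field b (m + 2) = ((m : ℝ) + 1) * b (m + 1) - ((m : ℝ) + 2) * b (m + 3) := by
  simp only [field, Nat.cast_add, Nat.cast_ofNat,
    show m + 2 - 1 = m + 1 from rfl, show m + 2 + 1 = m + 3 from rfl]
  ring

theorem field_one (b : ℕ → ℝ) : field b 1 = -b 2 := by simp [field]

/-- The equation at n = 1 gives b₂ = 0, and the others form a two-step recursion, so b₁ determines
everything. The value b₀ never enters: its coefficient is 0. -/
theorem isFixedPoint_iff (b : ℕ → ℝ) :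
    IsFixedPoint b ↔ ∀ n, b (n + 1) = b 1 * profile n := by
  constructor
  · intro h n
    induction n using Nat.twoStepInduction with
    | zero => simp [profile_zero]
    | one =>
      have := h 1 le_rfl
      rw [field_one] at this
      rw [profile_one]
      linarith
    | more n ih _ =>
      have := h (n + 2) (by omega)
      rw [field_add_two, ih] at this
      have h2 : (n : ℝ) + 2 ≠ 0 := by positivity
      apply mul_left_cancel₀ h2
      linear_combination -this - b 1 * profile_add_two n
  · rintro h (_ | _ | m) hn
    · omega
    · rw [zero_add, field_one, h 1, profile_one]
      simp
    · rw [show m + 1 + 1 = m + 2 from rfl, field_add_two, h m, h (m + 2)]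
      linear_combination -b 1 * profile_add_two m

theorem one_sub_sq_re_pos {z : ℂ} (hz : ‖z‖ < 1) : 0 < (1 - z ^ 2).re := by
  have h1 : (z ^ 2).re ≤ ‖z ^ 2‖ := Complex.re_le_norm _
  have h2 : ‖z ^ 2‖ < 1 := by
    rw [norm_pow]
    exact pow_lt_one₀ (norm_nonneg _) hz two_ne_zero
  simp only [Complex.sub_re, Complex.one_re]
  linarith

/-- Binomial series at -z², reindexed along the even integers. -/
theorem hasSum_profile {z : ℂ} (hz : ‖z‖ < 1) :
    HasSum (fun n : ℕ => (profile n : ℂ) * z ^ n) ((1 - z ^ 2) ^ (-1 / 2 : ℂ)) := by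
  have hz2 : ‖-z ^ 2‖ < 1 := by
    rw [norm_neg, norm_pow]
    exact pow_lt_one₀ (norm_nonneg _) hz two_ne_zero
  have h := (Complex.one_add_cpow_hasFPowerSeriesOnBall_zero (a := ((-1 / 2 : ℝ) : ℂ))).hasSum
    (y := -z ^ 2) (by
      rw [Metric.mem_eball, edist_zero_right, ← ofReal_norm, ← ENNReal.ofReal_one]
      exact (ENNReal.ofReal_lt_ofReal_iff one_pos).2 hz2)
  simp only [binomialSeries_apply, List.ofFn_const,
    List.prod_replicate, smul_eq_mul, ← Complex.ofReal_choose] at h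
  have hinj : Function.Injective (fun k : ℕ => 2 * k) := fun a b h => by simpa using h
  rw [← hinj.hasSum_iff]
  · have e : (fun n : ℕ => (profile n : ℂ) * z ^ n) ∘ (fun k : ℕ => 2 * k) =
        fun k => ((Ring.choose (-1 / 2 : ℝ) k : ℝ) : ℂ) * (-z ^ 2) ^ k := by
      ext k
      have h1 : 2 * k / 2 = k := by omega
      have h2 : Even (2 * k) := even_two_mul k
      simp only [Function.comp, profile, h1, h2, if_true]
      push_cast
      rw [neg_pow (z ^ 2), pow_mul]
      ring
    rw [e]
    simpa [sub_eq_add_neg] using h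
  · intro n hn
    have : ¬ Even n := fun ⟨k, hk⟩ => hn ⟨k, by change 2 * k = n; omega⟩
    simp [profile, this]

/-- Positive real part keeps w off the branch cut, so log(2/w) = log 2 - log w for principal
logarithms. -/
theorem two_div_cpow_half {w : ℂ} (hw : 0 < w.re) :
    (2 / w) ^ (1 / 2 : ℂ) = (√2 : ℝ) * w ^ (-1 / 2 : ℂ) := by
  have hw0 : w ≠ 0 := by rintro rfl; simp at hw
  have harg : |w.arg| < Real.pi / 2 := Complex.abs_arg_lt_pi_div_two_iff.2 (Or.inl hw)
  have hpi := Real.pi_pos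
  have hne : w.arg ≠ Real.pi := by
    intro h
    rw [h, abs_of_pos hpi] at harg
    linarith
  have hs : ((√2 : ℝ) : ℂ) = Complex.exp ((Real.log 2 : ℝ) * (1 / 2)) := by
    rw [Real.sqrt_eq_rpow, Real.rpow_def_of_pos two_pos]
    push_cast
    rfl
  have hlog := Complex.log_ofReal_mul two_pos (inv_ne_zero hw0)
  rw [Complex.ofReal_ofNat, ← div_eq_mul_inv, Complex.log_inv _ hne] at hlog
  rw [Complex.cpow_def_of_ne_zero (div_ne_zero two_ne_zero hw0), Complex.cpow_def_of_ne_zero hw0,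
    hlog, hs, ← Complex.exp_add]
  ring_nf

theorem hasFPowerSeriesAt_ofScalars {c : ℕ → ℂ} {f : ℂ → ℂ}
    (h : ∀ᶠ z in 𝓝 (0 : ℂ), HasSum (fun n => c n * z ^ n) (f z)) :
    HasFPowerSeriesAt f (FormalMultilinearSeries.ofScalars ℂ c) 0 := by
  rw [hasFPowerSeriesAt_iff]
  filter_upwards [h] with z hz
  simpa [FormalMultilinearSeries.coeff_ofScalars, mul_comm] using hz

theorem hasFixedPointForm_iff (b : ℕ → ℝ) (A : ℝ) :
    HasFixedPointForm b A ↔ ∀ n, b (n + 1) = A * √2 * profile n := by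
  have key : ∀ z : ℂ, ‖z‖ < 1 → HasSum (fun n : ℕ => ((A * √2 * profile n : ℝ) : ℂ) * z ^ n)
      ((A : ℂ) * (2 / (1 - z ^ 2)) ^ (1 / 2 : ℂ)) := by
    intro z hz
    rw [two_div_cpow_half (one_sub_sq_re_pos hz), ← mul_assoc]
    refine ((hasSum_profile hz).mul_left ((A : ℂ) * (√2 : ℝ))).congr_fun fun n => ?_
    push_cast
    ring
  constructor
  · intro h n
    have hball : ∀ᶠ z in 𝓝 (0 : ℂ), ‖z‖ < 1 := by
      filter_upwards [Metric.ball_mem_nhds (0 : ℂ) one_pos] with z hz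
      simpa using hz
    have e := (hasFPowerSeriesAt_ofScalars (c := fun n => (b (n + 1) : ℂ))
      (hball.mono h)).eq_formalMultilinearSeries
      (hasFPowerSeriesAt_ofScalars (c := fun n => ((A * √2 * profile n : ℝ) : ℂ))
        (hball.mono key))
    have := congrFun ((FormalMultilinearSeries.ofScalars_series_eq_iff ℂ _ _).1 e) n
    exact_mod_cast this
  · intro h z hz
    simpa only [h] using key z hz

theorem isFixedPoint_iff_exists_form (b : ℕ → ℝ) :
    IsFixedPoint b ↔ ∃ A : ℝ, HasFixedPointForm b A := by
  simp only [isFixedPoint_iff, hasFixedPointForm_iff]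
  constructor
  · intro h
    refine ⟨b 1 / √2, fun n => ?_⟩
    rw [div_mul_cancel₀ _ (by positivity)]
    exact h n
  · rintro ⟨A, h⟩ n
    rw [h n, h 0, profile_zero, mul_one]

/-! ### The adjoint system and the formula for the first coordinate. -/

/-- The coordinates of the solution of the adjoint system that starts at the first basis vector. -/
noncomputable def dual (n : ℕ) (u : ℝ) : ℝ :=
  (-Real.tanh u) ^ n / Real.cosh u

theorem hasDerivAt_tanh (u : ℝ) : HasDerivAt Real.tanh (1 - Real.tanh u ^ 2) u := by
  have h := (Real.hasDerivAt_sinh u).div (Real.hasDerivAt_cosh u) (Real.cosh_pos u).ne'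
  have e : Real.tanh = Real.sinh / Real.cosh := by
    ext x
    simp [Real.tanh_eq_sinh_div_cosh]
  rw [e]
  refine h.congr_deriv ?_
  have := (Real.cosh_pos u).ne'
  simp only [Pi.div_apply]
  field_simp

theorem hasDerivAt_dual (n : ℕ) (u : ℝ) :
    HasDerivAt (dual n) (((n : ℝ) + 1) * dual (n + 1) u - n * dual (n - 1) u) u := by
  have h := ((hasDerivAt_tanh u).neg.pow n).div (Real.hasDerivAt_cosh u) (Real.cosh_pos u).ne'
  refine h.congr_deriv ?_
  have hc := (Real.cosh_pos u).ne'
  have hs : Real.sinh u = Real.tanh u * Real.cosh u := by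
    rw [Real.tanh_eq_sinh_div_cosh]
    field_simp
  rcases n with _ | n
  · simp only [dual, Pi.neg_apply, hs]
    field_simp
    simp
  · simp only [dual, Pi.neg_apply, Pi.pow_apply, hs, Nat.add_sub_cancel]
    push_cast
    field_simp
    ring

theorem dual_zero_zero : dual 0 0 = 1 := by simp [dual]

theorem dual_succ_zero (n : ℕ) : dual (n + 1) 0 = 0 := by simp [dual]

theorem monotone_tanh : Monotone Real.tanh := by
  refine monotone_of_hasDerivAt_nonneg hasDerivAt_tanh fun u => ?_
  have := Real.tanh_sq_lt_one u
  simp only [Pi.zero_apply]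
  linarith

theorem tanh_nonneg {u : ℝ} (hu : 0 ≤ u) : 0 ≤ Real.tanh u := by
  simpa using monotone_tanh hu

theorem abs_dual_le {n : ℕ} {u v : ℝ} (hu : 0 ≤ u) (huv : u ≤ v) :
    |dual n u| ≤ Real.tanh v ^ n := by
  have h0 : 0 ≤ Real.tanh u := tanh_nonneg hu
  have h1 : Real.tanh u ≤ Real.tanh v := monotone_tanh huv
  rw [dual, abs_div, abs_pow, abs_neg, abs_of_nonneg h0, abs_of_pos (Real.cosh_pos u)]
  exact (div_le_self (by positivity) (Real.one_le_cosh u)).trans (pow_le_pow_left₀ h0 h1 n)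

/-- The pairing with the dual solution telescopes. -/
theorem hasDerivWithinAt_pairing {a : ℕ → ℝ → ℝ} (ha : IsGlobalSolution a) {s : ℝ}
    (hs : 0 ≤ s) (t : ℝ) (N : ℕ) :
    HasDerivWithinAt (fun s => ∑ n ∈ Finset.range N, a (n + 1) s * dual n (t - s))
      (-(N * (a N s * dual N (t - s) + a (N + 1) s * dual (N - 1) (t - s)))) (Ici 0) s := by
  have hd : ∀ n, HasDerivWithinAt (fun s => dual n (t - s))
      (-(((n : ℝ) + 1) * dual (n + 1) (t - s) - n * dual (n - 1) (t - s))) (Ici 0) s := by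
    intro n
    have := (hasDerivAt_dual n (t - s)).comp s ((hasDerivAt_id s).const_sub t)
    simpa [Function.comp_def] using this.hasDerivWithinAt
  have h := HasDerivWithinAt.fun_sum (u := Finset.range N) fun n _ =>
    (ha.equation (n + 1) (by omega) s hs).mul (hd n)
  refine h.congr_deriv ?_
  clear h
  induction N with
  | zero => simp
  | succ N ih =>
    rw [Finset.sum_range_succ, ih]
    simp only [field, Nat.add_sub_cancel]
    push_cast
    ring

theorem IsGlobalSolution.exists_bound {a : ℕ → ℝ → ℝ} (ha : IsGlobalSolution a) {T : ℝ}
    (hT : 0 ≤ T) :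
    ∃ C γ : ℝ, 0 ≤ C ∧ 1 ≤ γ ∧ ∀ n : ℕ, 1 ≤ n → ∀ t ∈ Icc 0 T, |a n t| ≤ C * γ ^ n := by
  obtain ⟨C, γ, h⟩ := ha.growth T hT
  refine ⟨|C|, max 1 |γ|, abs_nonneg _, le_max_left _ _, fun n hn t ht => ?_⟩
  calc |a n t| ≤ C * γ ^ n := h n hn t ht
    _ ≤ |C * γ ^ n| := le_abs_self _
    _ = |C| * |γ| ^ n := by rw [abs_mul, abs_pow]
    _ ≤ |C| * max 1 |γ| ^ n := by
      gcongr
      exact le_max_right _ _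

/-- Only the boundary terms at N survive in the derivative of the truncated pairing. They are of
order N (γ tanh(t - s))^N, so in the limit the pairing is constant on [s, t]; at the endpoint t it
equals a₁(t). -/
theorem tendsto_pairing {a : ℕ → ℝ → ℝ} (ha : IsGlobalSolution a) {C γ s t : ℝ}
    (hC : 0 ≤ C) (hγ : 1 ≤ γ) (hs : 0 ≤ s) (hst : s ≤ t)
    (hb : ∀ n : ℕ, 1 ≤ n → ∀ r ∈ Icc s t, |a n r| ≤ C * γ ^ n)
    (hlt : γ * Real.tanh (t - s) < 1) :
    Tendsto (fun N => ∑ n ∈ Finset.range N, a (n + 1) s * dual n (t - s)) atTop (𝓝 (a 1 t)) := by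
  set q := Real.tanh (t - s) with hq
  have hq0 : 0 ≤ q := tanh_nonneg (by linarith)
  have hq1 : q ≤ 1 := (Real.tanh_lt_one _).le
  have hγ0 : 0 ≤ γ := by linarith
  -- At zero elapsed time the dual vector is the first basis vector; `N + 1` keeps the term n = 0 in
  -- the sum.
  have hend : ∀ N, ∑ n ∈ Finset.range (N + 1), a (n + 1) t * dual n (t - t) = a 1 t := by
    intro N
    rw [Finset.sum_range_succ', sub_self]
    simp [dual_succ_zero, dual_zero_zero]
  have hbound : ∀ N, |a 1 t - ∑ n ∈ Finset.range (N + 1), a (n + 1) s * dual n (t - s)| ≤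
      (((N + 1 : ℕ) : ℝ) * (2 * C * γ ^ 2) * (γ * q) ^ N) * (t - s) := by
    intro N
    have hder : ∀ r ∈ Icc s t, HasDerivWithinAt
        (fun s => ∑ n ∈ Finset.range (N + 1), a (n + 1) s * dual n (t - s))
        (-(((N + 1 : ℕ) : ℝ) * (a (N + 1) r * dual (N + 1) (t - r) +
          a (N + 1 + 1) r * dual (N + 1 - 1) (t - r)))) (Icc s t) r := fun r hr =>
      (hasDerivWithinAt_pairing ha (hs.trans hr.1) t (N + 1)).mono
        fun x hx => hs.trans hx.1
    have hle : ∀ r ∈ Icc s t, ‖-(((N + 1 : ℕ) : ℝ) * (a (N + 1) r * dual (N + 1) (t - r) +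
        a (N + 1 + 1) r * dual (N + 1 - 1) (t - r)))‖ ≤
        ((N + 1 : ℕ) : ℝ) * (2 * C * γ ^ 2) * (γ * q) ^ N := by
      intro r hr
      have d1 : |dual (N + 1) (t - r)| ≤ q ^ (N + 1) :=
        abs_dual_le (by linarith [hr.2]) (by linarith [hr.1])
      have d2 : |dual N (t - r)| ≤ q ^ N :=
        abs_dual_le (by linarith [hr.2]) (by linarith [hr.1])
      have b1 := hb (N + 1) (by omega) r hr
      have b2 := hb (N + 1 + 1) (by omega) r hr
      have d1' : |dual (N + 1) (t - r)| ≤ q ^ N := d1.trans (pow_le_pow_of_le_one hq0 hq1 (by omega))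
      have b1' : |a (N + 1) r| ≤ C * γ ^ (N + 2) :=
        b1.trans (mul_le_mul_of_nonneg_left (pow_le_pow_right₀ hγ (by omega)) hC)
      rw [norm_neg, norm_mul, Real.norm_natCast, mul_assoc, Nat.add_sub_cancel]
      refine mul_le_mul_of_nonneg_left ?_ (Nat.cast_nonneg _)
      calc |a (N + 1) r * dual (N + 1) (t - r) + a (N + 1 + 1) r * dual N (t - r)|
          ≤ |a (N + 1) r| * |dual (N + 1) (t - r)| + |a (N + 1 + 1) r| * |dual N (t - r)| := by
            rw [← abs_mul, ← abs_mul]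
            exact abs_add_le _ _
        _ ≤ C * γ ^ (N + 2) * q ^ N + C * γ ^ (N + 2) * q ^ N := by
            gcongr
        _ = 2 * C * γ ^ 2 * (γ * q) ^ N := by
            rw [mul_pow]
            ring
    have := Convex.norm_image_sub_le_of_norm_hasDerivWithin_le hder hle (convex_Icc s t)
      (left_mem_Icc.2 hst) (right_mem_Icc.2 hst)
    rw [hend, Real.norm_eq_abs, Real.norm_eq_abs, abs_of_nonneg (sub_nonneg.2 hst)] at this
    exact this
  have hlim : Tendsto (fun N : ℕ => (((N + 1 : ℕ) : ℝ) * (2 * C * γ ^ 2) * (γ * q) ^ N) * (t - s))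
      atTop (𝓝 0) := by
    have hp : 0 ≤ γ * q := mul_nonneg hγ0 hq0
    have l1 := tendsto_self_mul_const_pow_of_lt_one hp hlt
    have l2 := tendsto_pow_atTop_nhds_zero_of_lt_one hp hlt
    have := (l1.add l2).const_mul ((2 * C * γ ^ 2) * (t - s))
    simp only [add_zero, mul_zero] at this
    refine this.congr fun N => ?_
    push_cast
    ring
  rw [← tendsto_add_atTop_iff_nat 1, tendsto_iff_dist_tendsto_zero]
  refine squeeze_zero (fun _ => dist_nonneg) (fun N => ?_) hlim
  rw [dist_comm, Real.dist_eq]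
  exact hbound N

/-- The generating function at time `s`, evaluated at `-tanh (t - s)`, is `a₁(t) cosh (t - s)`. -/
theorem hasSum_neg_tanh {a : ℕ → ℝ → ℝ} (ha : IsGlobalSolution a) {C γ s t : ℝ}
    (hC : 0 ≤ C) (hγ : 1 ≤ γ) (hs : 0 ≤ s) (hst : s ≤ t)
    (hb : ∀ n : ℕ, 1 ≤ n → ∀ r ∈ Icc s t, |a n r| ≤ C * γ ^ n)
    (hlt : γ * Real.tanh (t - s) < 1) :
    HasSum (fun n => a (n + 1) s * (-Real.tanh (t - s)) ^ n) (a 1 t * Real.cosh (t - s)) := by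
  have hq0 : 0 ≤ Real.tanh (t - s) := tanh_nonneg (by linarith)
  have hγ0 : 0 ≤ γ := by linarith
  have hsum : Summable (fun n => a (n + 1) s * (-Real.tanh (t - s)) ^ n) := by
    refine Summable.of_norm_bounded
      ((summable_geometric_of_lt_one (mul_nonneg hγ0 hq0) hlt).mul_left (C * γ)) fun n => ?_
    rw [norm_mul, norm_pow, norm_neg, Real.norm_eq_abs, Real.norm_eq_abs, abs_of_nonneg hq0]
    calc _ ≤ C * γ ^ (n + 1) * Real.tanh (t - s) ^ n := by
          gcongr
          exact hb _ (by omega) _ (left_mem_Icc.2 hst)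
      _ = _ := by rw [mul_pow]; ring
  have hlim := (tendsto_pairing ha hC hγ hs hst hb hlt).mul_const (Real.cosh (t - s))
  refine (hsum.hasSum_iff_tendsto_nat).2 (hlim.congr fun N => ?_)
  rw [Finset.sum_mul]
  refine Finset.sum_congr rfl fun n _ => ?_
  rw [dual, mul_assoc, div_mul_cancel₀ _ (Real.cosh_pos _).ne']

/-! ### Gluing local analytic extensions along (-1, 0]. -/

theorem frequently_nhdsNE_of_real {p : ℝ} {P : ℂ → Prop} (h : ∀ᶠ y : ℝ in 𝓝[<] p, P y) :
    ∃ᶠ z in 𝓝[≠] (p : ℂ), P z := by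
  have ht : Tendsto (fun y : ℝ => (y : ℂ)) (𝓝[<] p) (𝓝[≠] (p : ℂ)) := by
    refine tendsto_nhdsWithin_of_tendsto_nhds_of_eventually_within _
      (Complex.continuous_ofReal.continuousAt.tendsto.mono_left nhdsWithin_le_nhds) ?_
    filter_upwards [self_mem_nhdsWithin] with y hy
    simpa using (mem_Iio.1 hy).ne
  exact ht.frequently h.frequently

/-- Local analytic extensions of a function on `(-1, 0]` fit together. -/
theorem exists_analytic_glue {g : ℝ → ℂ}
    (h : ∀ x ∈ Ioc (-1 : ℝ) 0, ∃ f : ℂ → ℂ, AnalyticAt ℂ f x ∧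
      ∀ᶠ y : ℝ in 𝓝[Iic 0] x, f y = g y) :
    ∃ F : ℂ → ℂ, AnalyticOnNhd ℂ F negInterval ∧ ∀ x ∈ Ioc (-1 : ℝ) 0, F x = g x := by
  have h1 : ∀ x ∈ Ioc (-1 : ℝ) 0, ∃ f : ℂ → ℂ, ∃ r > 0,
      AnalyticOnNhd ℂ f (Metric.ball (x : ℂ) r) ∧ ∀ y : ℝ, y ≤ 0 → |y - x| < r → f y = g y := by
    intro x hx
    obtain ⟨f, hf, hfg⟩ := h x hx
    obtain ⟨r₁, hr₁, hb⟩ := Metric.mem_nhds_iff.1 hf.eventually_analyticAt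
    obtain ⟨r₂, hr₂, hb'⟩ := Metric.mem_nhdsWithin_iff.1 hfg
    refine ⟨f, min r₁ r₂, lt_min hr₁ hr₂,
      fun z hz => hb (Metric.ball_subset_ball (min_le_left _ _) hz), fun y hy hyr => ?_⟩
    exact hb' ⟨by simpa [Real.dist_eq] using hyr.trans_le (min_le_right _ _), hy⟩
  choose! f r hr hf hfg using h1
  classical
  let F : ℂ → ℂ := fun z =>
    if hz : ∃ x ∈ Ioc (-1 : ℝ) 0, z ∈ Metric.ball (x : ℂ) (r x) then f hz.choose z else 0
  have hF : ∀ x ∈ Ioc (-1 : ℝ) 0, EqOn F (f x) (Metric.ball (x : ℂ) (r x)) := by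
    intro x hx z hz
    have hex : ∃ x ∈ Ioc (-1 : ℝ) 0, z ∈ Metric.ball (x : ℂ) (r x) := ⟨x, hx, hz⟩
    have hFz : F z = f hex.choose z := dif_pos hex
    obtain ⟨hx', hz'⟩ := hex.choose_spec
    set x' := hex.choose
    rw [hFz]
    -- A real point common to both balls: projecting z to the nonpositive reals does not increase
    -- its distance to a centre in (-1, 0]. To the left of p both local functions equal `g`, so the
    -- identity theorem applies on the convex intersection.
    set p : ℝ := min z.re 0 with hp
    have hproj : ∀ x ∈ Ioc (-1 : ℝ) 0, z ∈ Metric.ball (x : ℂ) (r x) → |p - x| < r x := by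
      intro x hx hz
      have h1 : |z.re - x| < r x := by
        have := Complex.abs_re_le_norm (z - x)
        rw [Complex.sub_re, Complex.ofReal_re] at this
        exact this.trans_lt (by simpa [dist_eq_norm] using hz)
      refine lt_of_le_of_lt ?_ h1
      rcases le_total z.re 0 with h0 | h0
      · rw [hp, min_eq_left h0]
      · rw [hp, min_eq_right h0, abs_of_nonneg (by linarith [hx.2]),
          abs_of_nonneg (by linarith [hx.2])]
        linarith
    have hpre : IsPreconnected (Metric.ball (x : ℂ) (r x) ∩ Metric.ball (x' : ℂ) (r x')) :=
      ((convex_ball _ _).inter (convex_ball _ _)).isPreconnected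
    have hball : ∀ x : ℝ, |p - x| < r x → (p : ℂ) ∈ Metric.ball (x : ℂ) (r x) := by
      intro x hx
      rw [Metric.mem_ball, Complex.dist_eq, ← Complex.ofReal_sub, Complex.norm_real]
      exact hx
    refine AnalyticOnNhd.eqOn_of_preconnected_of_frequently_eq
      ((hf x' hx').mono inter_subset_right) ((hf x hx).mono inter_subset_left) hpre
      ⟨hball x (hproj x hx hz), hball x' (hproj x' hx' hz')⟩ ?_ ⟨hz, hz'⟩
    refine frequently_nhdsNE_of_real ?_
    have hev : ∀ x : ℝ, |p - x| < r x → ∀ᶠ y in 𝓝[<] p, |y - x| < r x := fun x hx =>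
      nhdsWithin_le_nhds ((isOpen_lt (by fun_prop) continuous_const).mem_nhds hx)
    filter_upwards [self_mem_nhdsWithin, hev x (hproj x hx hz), hev x' (hproj x' hx' hz')]
      with y hy h1 h2
    have hy0 : y ≤ 0 := (mem_Iio.1 hy).le.trans (min_le_right _ _)
    rw [hfg x hx y hy0 h1, hfg x' hx' y hy0 h2]
  refine ⟨F, ?_, fun x hx => ?_⟩
  · rintro _ ⟨x, hx, rfl⟩
    refine (hf x hx x (Metric.mem_ball_self (hr x hx))).congr ?_
    filter_upwards [Metric.ball_mem_nhds (x : ℂ) (hr x hx)] with z hz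
    exact (hF x hx hz).symm
  · rw [hF x hx (Metric.mem_ball_self (hr x hx)), hfg x hx x hx.2 (by simpa using hr x hx)]

/-! ### Transport along characteristics by Möbius maps. -/

theorem summable_of_geometric_bound {c : ℕ → ℂ} {K γ : ℝ} (hc : ∀ n, ‖c n‖ ≤ K * γ ^ n) {z : ℂ}
    {ρ : ℝ} (hz : ‖z‖ ≤ ρ) (hγ : 0 ≤ γ) (hρ : γ * ρ < 1) :
    Summable (fun n => K * (γ * ρ) ^ n) ∧ ∀ n, ‖c n * z ^ n‖ ≤ K * (γ * ρ) ^ n := by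
  have hρ0 : 0 ≤ ρ := (norm_nonneg z).trans hz
  refine ⟨(summable_geometric_of_lt_one (mul_nonneg hγ hρ0) hρ).mul_left K, fun n => ?_⟩
  rw [norm_mul, norm_pow, mul_pow, ← mul_assoc]
  have := hc n
  have hK : 0 ≤ K * γ ^ n := (norm_nonneg _).trans this
  gcongr

theorem analyticAt_tsum_of_geometric_bound {c : ℕ → ℂ} {K γ : ℝ} (hc : ∀ n, ‖c n‖ ≤ K * γ ^ n)
    (hγ : 0 < γ) {z : ℂ} (hz : γ * ‖z‖ < 1) : AnalyticAt ℂ (fun z => ∑' n, c n * z ^ n) z := by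
  obtain ⟨ρ, hρ₁, hρ₂⟩ := exists_between ((lt_div_iff₀' hγ).2 hz)
  have hρ : γ * ρ < 1 := (lt_div_iff₀' hγ).1 hρ₂
  have hd : DifferentiableOn ℂ (fun z => ∑' n, c n * z ^ n) (Metric.ball 0 ρ) := by
    refine Complex.differentiableOn_tsum_of_summable_norm (u := fun n => K * (γ * ρ) ^ n)
      (summable_of_geometric_bound hc (z := z) hρ₁.le hγ.le hρ).1 (fun n => by fun_prop)
      Metric.isOpen_ball fun n w hw => ?_
    exact (summable_of_geometric_bound hc (by simpa using (mem_ball_zero_iff.1 hw).le) hγ.le hρ).2 n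
  exact hd.analyticAt (Metric.isOpen_ball.mem_nhds (by simpa using hρ₁))

/-- The generating function at time `s`, transported back to time `0`. -/
noncomputable def chart (a : ℕ → ℝ → ℝ) (s : ℝ) (w : ℂ) : ℂ :=
  (∑' n, (a (n + 1) s : ℂ) * ((w + Real.tanh s) / (1 + w * Real.tanh s)) ^ n) /
    (Real.cosh s * (1 + w * Real.tanh s))

theorem one_sub_tanh_mul_tanh_pos (s t : ℝ) : 0 < 1 - Real.tanh t * Real.tanh s := by
  have h1 := Real.abs_tanh_lt_one s
  have h2 := Real.abs_tanh_lt_one t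
  have h3 : |Real.tanh t * Real.tanh s| < 1 := by
    rw [abs_mul]
    exact mul_lt_one_of_nonneg_of_lt_one_left (abs_nonneg _) h2 h1.le
  linarith [(abs_lt.1 h3).2]

theorem cosh_sub_eq (s t : ℝ) :
    Real.cosh (t - s) = Real.cosh t * (Real.cosh s * (1 - Real.tanh t * Real.tanh s)) := by
  have h1 := (Real.cosh_pos s).ne'
  have h2 := (Real.cosh_pos t).ne'
  rw [Real.cosh_sub, Real.tanh_eq_sinh_div_cosh, Real.tanh_eq_sinh_div_cosh]
  field_simp

theorem tanh_sub_eq (s t : ℝ) :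
    Real.tanh (t - s) = (Real.tanh t - Real.tanh s) / (1 - Real.tanh t * Real.tanh s) := by
  have h1 := (Real.cosh_pos s).ne'
  have h2 := (Real.cosh_pos t).ne'
  have h3 := (one_sub_tanh_mul_tanh_pos s t).ne'
  rw [Real.tanh_eq_sinh_div_cosh (t - s), cosh_sub_eq, Real.sinh_sub,
    div_eq_div_iff (by positivity) h3, Real.tanh_eq_sinh_div_cosh, Real.tanh_eq_sinh_div_cosh]
  field_simp

theorem moebius_neg_tanh (s t : ℝ) :
    (((-Real.tanh t : ℝ) : ℂ) + Real.tanh s) / (1 + ((-Real.tanh t : ℝ) : ℂ) * Real.tanh s) =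
      ((-Real.tanh (t - s) : ℝ) : ℂ) := by
  rw [tanh_sub_eq]
  push_cast
  rw [← neg_div]
  congr 1 <;> ring

/-- The subtraction formulas for tanh and cosh cancel the dependence on s; this is why charts from
different starting times agree on the real axis. -/
theorem chart_neg_tanh {a : ℕ → ℝ → ℝ} (ha : IsGlobalSolution a) {C γ s t : ℝ}
    (hC : 0 ≤ C) (hγ : 1 ≤ γ) (hs : 0 ≤ s) (hst : s ≤ t)
    (hb : ∀ n : ℕ, 1 ≤ n → ∀ r ∈ Icc s t, |a n r| ≤ C * γ ^ n)
    (hlt : γ * Real.tanh (t - s) < 1) :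
    chart a s ((-Real.tanh t : ℝ) : ℂ) = ((a 1 t * Real.cosh t : ℝ) : ℂ) := by
  have h := (hasSum_neg_tanh ha hC hγ hs hst hb hlt).tsum_eq
  have h3 := (one_sub_tanh_mul_tanh_pos s t).ne'
  have h4 := (Real.cosh_pos s).ne'
  rw [chart, moebius_neg_tanh]
  have e : a 1 t * Real.cosh t =
      (a 1 t * Real.cosh (t - s)) / (Real.cosh s * (1 - Real.tanh t * Real.tanh s)) := by
    rw [cosh_sub_eq]
    field_simp
  rw [e, ← h]
  push_cast
  rw [neg_mul, ← sub_eq_add_neg]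

theorem analyticAt_chart {a : ℕ → ℝ → ℝ} {C γ s t : ℝ} (hγ : 1 ≤ γ) (hst : s ≤ t)
    (hb : ∀ n : ℕ, 1 ≤ n → |a n s| ≤ C * γ ^ n) (hlt : γ * Real.tanh (t - s) < 1) :
    AnalyticAt ℂ (chart a s) ((-Real.tanh t : ℝ) : ℂ) := by
  have h3 := one_sub_tanh_mul_tanh_pos s t
  have hne : (1 : ℂ) + ((-Real.tanh t : ℝ) : ℂ) * Real.tanh s ≠ 0 := by
    have : ((1 - Real.tanh t * Real.tanh s : ℝ) : ℂ) ≠ 0 := by exact_mod_cast h3.ne'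
    push_cast at this ⊢
    rwa [neg_mul, ← sub_eq_add_neg]
  have hcosh : (Real.cosh s : ℂ) ≠ 0 := by exact_mod_cast (Real.cosh_pos s).ne'
  have hG : AnalyticAt ℂ (fun z : ℂ => ∑' n, (a (n + 1) s : ℂ) * z ^ n)
      ((-Real.tanh (t - s) : ℝ) : ℂ) := by
    refine analyticAt_tsum_of_geometric_bound (K := C * γ) (γ := γ) (fun n => ?_)
      (by linarith) ?_
    · rw [Complex.norm_real, Real.norm_eq_abs, mul_assoc, ← pow_succ']
      exact hb _ (by omega)
    · rw [Complex.norm_real, norm_neg, Real.norm_eq_abs, abs_of_nonneg (tanh_nonneg (by linarith))]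
      exact hlt
  have hm : AnalyticAt ℂ (fun w : ℂ => (w + Real.tanh s) / (1 + w * Real.tanh s))
      ((-Real.tanh t : ℝ) : ℂ) := by
    refine AnalyticAt.div (by fun_prop) (by fun_prop) hne
  rw [← moebius_neg_tanh] at hG
  refine AnalyticAt.div (AnalyticAt.fun_comp (f := fun w : ℂ => (w + Real.tanh s) / (1 + w * Real.tanh s))
    hG hm) (by fun_prop) (mul_ne_zero hcosh hne)

/-! ### Continuation of the initial generating function to (-1, 0]. -/

theorem continuousAt_artanh {x : ℝ} (hx : x ∈ Ioo (-1) 1) : ContinuousAt Real.artanh x := by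
  have h1 : 0 < 1 - x := by linarith [hx.2]
  have h2 : 0 < 1 + x := by linarith [hx.1]
  have h3 : √((1 + x) / (1 - x)) ≠ 0 := (Real.sqrt_pos.2 (by positivity)).ne'
  unfold Real.artanh
  refine ContinuousAt.log ?_ h3
  refine Real.continuous_sqrt.continuousAt.comp (ContinuousAt.div (by fun_prop) (by fun_prop) h1.ne')

theorem exists_tanh_lt (γ : ℝ) : ∃ δ > 0, γ * Real.tanh δ < 1 := by
  have hc : ContinuousAt (fun u => γ * Real.tanh u) 0 :=
    continuousAt_const.mul (hasDerivAt_tanh 0).continuousAt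
  have h0 : γ * Real.tanh 0 < 1 := by simp
  have := (hc.eventually_lt continuousAt_const h0).filter_mono (nhdsWithin_le_nhds (s := Ioi 0))
  obtain ⟨δ, h1, h2⟩ := (this.and self_mem_nhdsWithin).exists
  exact ⟨δ, h2, h1⟩

/-- The values that the generating function at time `0` takes on `(-1, 0]`. -/
noncomputable def trace (a : ℕ → ℝ → ℝ) (y : ℝ) : ℝ :=
  a 1 (Real.artanh (-y)) * Real.cosh (Real.artanh (-y))

theorem chart_eq_trace {a : ℕ → ℝ → ℝ} (ha : IsGlobalSolution a) {C γ s T y δ : ℝ}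
    (hC : 0 ≤ C) (hγ : 1 ≤ γ) (hs : 0 ≤ s) (hy : y ∈ Ioo (-1) 1)
    (hb : ∀ n : ℕ, 1 ≤ n → ∀ r ∈ Icc 0 T, |a n r| ≤ C * γ ^ n) (hδ : γ * Real.tanh δ < 1)
    (h₁ : s ≤ Real.artanh (-y)) (h₂ : Real.artanh (-y) ≤ s + δ) (h₃ : Real.artanh (-y) ≤ T) :
    chart a s y = trace a y := by
  have hy' : -y ∈ Ioo (-1 : ℝ) 1 := ⟨by linarith [hy.2], by linarith [hy.1]⟩
  have := chart_neg_tanh ha hC hγ hs h₁ (fun n hn r hr => hb n hn r ⟨hs.trans hr.1, hr.2.trans h₃⟩)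
    (lt_of_le_of_lt (mul_le_mul_of_nonneg_left (monotone_tanh (by linarith)) (by linarith)) hδ)
  rwa [Real.tanh_artanh hy', neg_neg] at this

theorem exists_local_extension {a : ℕ → ℝ → ℝ} (ha : IsGlobalSolution a) {x : ℝ}
    (hx : x ∈ Ioc (-1 : ℝ) 0) :
    ∃ f : ℂ → ℂ, AnalyticAt ℂ f x ∧ ∀ᶠ y : ℝ in 𝓝[Iic 0] x, f y = trace a y := by
  have hx' : -x ∈ Ioo (-1 : ℝ) 1 := ⟨by linarith [hx.2], by linarith [hx.1]⟩
  set t := Real.artanh (-x) with ht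
  have ht0 : 0 ≤ t := Real.artanh_nonneg (by linarith [hx.2])
  -- The extra unit of time covers the points y just to the left of x, whose times exceed t.
  obtain ⟨C, γ, hC, hγ, hb⟩ := ha.exists_bound (T := t + 1) (by linarith)
  obtain ⟨δ, hδ, hδ'⟩ := exists_tanh_lt γ
  -- Starting just before t puts t inside the window [s, s + δ]. When t = 0 there is no earlier
  -- time, and only y ≤ 0 is reached.
  set s := max 0 (t - δ / 2) with hs
  have hs0 : 0 ≤ s := le_max_left _ _
  have hst : s ≤ t := max_le ht0 (by linarith)
  have hsδ : t < s + δ := by linarith [le_max_right 0 (t - δ / 2)]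
  refine ⟨chart a s, ?_, ?_⟩
  · have := analyticAt_chart (a := a) hγ hst (fun n hn => hb n hn s ⟨hs0, by linarith⟩)
      (lt_of_le_of_lt (mul_le_mul_of_nonneg_left (monotone_tanh (by linarith)) (by linarith)) hδ')
    rwa [ht, Real.tanh_artanh hx', neg_neg] at this
  · have hc : ContinuousAt (fun y : ℝ => Real.artanh (-y)) x :=
      (continuousAt_artanh hx').comp (f := fun y : ℝ => -y) continuous_neg.continuousAt
    have hlo : ∀ᶠ y in 𝓝[Iic 0] x, s ≤ Real.artanh (-y) := by
      rcases ht0.eq_or_lt with h0 | h0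
      · have : s = 0 := le_antisymm (hst.trans h0.ge) hs0
        filter_upwards [self_mem_nhdsWithin] with y hy
        rw [this]
        exact Real.artanh_nonneg (by linarith [mem_Iic.1 hy])
      · have : s < t := max_lt h0 (by linarith)
        exact ((continuousAt_const.eventually_lt hc this).mono fun _ h => h.le).filter_mono
          nhdsWithin_le_nhds
    have e1 := (hc.eventually_lt continuousAt_const hsδ).filter_mono
      (nhdsWithin_le_nhds (s := Iic 0))
    have e2 := (hc.eventually_lt continuousAt_const (lt_add_one t)).filter_mono
      (nhdsWithin_le_nhds (s := Iic 0))
    have e3 : ∀ᶠ y in 𝓝[Iic 0] x, y ∈ Ioo (-1 : ℝ) 1 :=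
      nhdsWithin_le_nhds (Ioo_mem_nhds hx.1 (by linarith [hx.2]))
    filter_upwards [hlo, e1, e2, e3] with y h1 h2 h3 h4
    exact chart_eq_trace ha hC hγ hs0 h4 hb hδ' h1 h2.le h3.le

theorem exists_generatingFunction {a : ℕ → ℝ → ℝ} (ha : IsGlobalSolution a) :
    ∃ F : ℂ → ℂ, IsGeneratingFunction (fun n => a n 0) F ∧
      ∀ x ∈ Ioc (-1 : ℝ) 0, F x = trace a x := by
  obtain ⟨F, hF, hFt⟩ := exists_analytic_glue (g := fun y => (trace a y : ℂ))
    fun x hx => exists_local_extension ha hx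
  refine ⟨F, ⟨hF, ?_⟩, hFt⟩
  obtain ⟨C, γ, hC, hγ, hb⟩ := ha.exists_bound (T := 1) (by norm_num)
  obtain ⟨δ, hδ, hδ'⟩ := exists_tanh_lt γ
  have hb0 : ∀ n : ℕ, 1 ≤ n → |a n 0| ≤ C * γ ^ n := fun n hn => hb n hn 0 (by simp)
  have hchart : ∀ w, chart a 0 w = ∑' n, (a (n + 1) 0 : ℂ) * w ^ n := by
    intro w
    simp [chart]
  have han : AnalyticAt ℂ (chart a 0) 0 := by
    simpa using analyticAt_chart (a := a) hγ (le_refl 0) hb0 (by simp)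
  have h0 : (0 : ℝ) ∈ Ioc (-1 : ℝ) 0 := by norm_num
  have hF0 : AnalyticAt ℂ F 0 := hF 0 ⟨0, h0, by simp⟩
  have heq : ∀ᶠ z in 𝓝 (0 : ℂ), F z = chart a 0 z := by
    -- The glued function is known only on the real segment, so the identity theorem is needed to
    -- recover the power series near 0.
    rw [← hF0.frequently_eq_iff_eventually_eq han]
    have hc : ContinuousAt (fun y : ℝ => Real.artanh (-y)) 0 :=
      (continuousAt_artanh (by norm_num)).comp (f := fun y : ℝ => -y) continuous_neg.continuousAt
    have hmin : Real.artanh (-0) < min δ 1 := by simpa using hδ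
    have e1 := (hc.eventually_lt continuousAt_const hmin).filter_mono
      (nhdsWithin_le_nhds (s := Iio 0))
    have e2 : ∀ᶠ y in 𝓝[<] (0 : ℝ), -1 < y := nhdsWithin_le_nhds (Ioi_mem_nhds (by norm_num))
    have := frequently_nhdsNE_of_real (p := 0) (P := fun z => F z = chart a 0 z) (by
      filter_upwards [e1, e2, self_mem_nhdsWithin] with y h1 h2 h3
      rw [mem_Iio] at h3
      rw [hFt y ⟨h2, h3.le⟩, chart_eq_trace ha hC hγ le_rfl ⟨h2, by linarith⟩ hb hδ'
        (Real.artanh_nonneg (by linarith)) (by linarith [min_le_left δ 1])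
        (by linarith [min_le_right δ 1])])
    simpa using this
  have hball : ∀ᶠ z in 𝓝 (0 : ℂ), γ * ‖z‖ < 1 :=
    ContinuousAt.eventually_lt (by fun_prop) continuousAt_const (by simp)
  filter_upwards [heq, hball] with z hz hz'
  rw [hz, hchart]
  have hs := summable_of_geometric_bound (c := fun n => (a (n + 1) 0 : ℂ)) (K := C * γ) (γ := γ)
    (fun n => by
      rw [Complex.norm_real, Real.norm_eq_abs, mul_assoc, ← pow_succ']
      exact hb0 _ (by omega)) (le_refl ‖z‖) (by linarith) hz'
  exact (Summable.of_norm_bounded hs.1 hs.2).hasSum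

theorem IsGeneratingFunction.eqOn {b : ℕ → ℝ} {F G : ℂ → ℂ} (hF : IsGeneratingFunction b F)
    (hG : IsGeneratingFunction b G) : EqOn F G negInterval := by
  refine hF.1.eqOn_of_preconnected_of_eventuallyEq hG.1
    (isPreconnected_Ioc.image _ Complex.continuous_ofReal.continuousOn) (z₀ := 0)
    ⟨0, by norm_num, by simp⟩ ?_
  filter_upwards [hF.2, hG.2] with z h1 h2 using h1.unique h2

/-- On `(-1, 0]` the generating function at time `0` is determined by the first coordinate. -/
theorem IsGeneratingFunction.mul_sqrt {a : ℕ → ℝ → ℝ} (ha : IsGlobalSolution a) {G : ℂ → ℂ}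
    (hG : IsGeneratingFunction (fun n => a n 0) G) {x : ℝ} (hx : x ∈ Ioc (-1 : ℝ) 0) :
    G x * (√(1 - x ^ 2) : ℝ) = a 1 (Real.artanh (-x)) := by
  obtain ⟨F, hF, hFt⟩ := exists_generatingFunction ha
  have hx' : -x ∈ Ioo (-1 : ℝ) 1 := ⟨by linarith [hx.2], by linarith [hx.1]⟩
  have hpos : √(1 - x ^ 2) ≠ 0 := (Real.sqrt_pos.2 (by nlinarith [hx.1, hx.2])).ne'
  rw [hG.eqOn hF ⟨x, hx, rfl⟩, hFt x hx, trace, Real.cosh_artanh hx', neg_sq, ← Complex.ofReal_mul,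
    mul_assoc, one_div, inv_mul_cancel₀ hpos, mul_one]

/-! ### The limit vector and the behaviour of G₀ at -1. -/

/-- The mean value theorem on [n, n + 1] gives points tending to infinity at which the derivative
equals an increment of f, and these increments vanish in the limit. -/
theorem derivative_limit_eq_zero {f f' : ℝ → ℝ} {l c : ℝ}
    (hd : ∀ t, 0 ≤ t → HasDerivWithinAt f (f' t) (Ici 0) t) (hf : Tendsto f atTop (𝓝 l))
    (hf' : Tendsto f' atTop (𝓝 c)) : c = 0 := by
  have hmv : ∀ n : ℕ, ∃ ξ ∈ Ioo (n : ℝ) (n + 1), f' ξ = f (n + 1) - f n := by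
    intro n
    have hn : (0 : ℝ) ≤ n := Nat.cast_nonneg n
    obtain ⟨ξ, hξ, h⟩ := exists_hasDerivAt_eq_slope f f' (lt_add_one (n : ℝ))
      (fun t ht => ((hd t (hn.trans ht.1)).continuousWithinAt).mono fun s hs => hn.trans hs.1)
      (fun t ht => (hd t (hn.trans ht.1.le)).hasDerivAt (Ici_mem_nhds (hn.trans_lt ht.1)))
    exact ⟨ξ, hξ, by rw [h]; simp⟩
  choose ξ hξ h using hmv
  have hξ' : Tendsto ξ atTop atTop :=
    tendsto_atTop_mono (fun n => (hξ n).1.le) tendsto_natCast_atTop_atTop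
  have h1 := hf'.comp hξ'
  have h2 : Tendsto (fun n : ℕ => f ((n : ℝ) + 1) - f n) atTop (𝓝 (l - l)) :=
    (hf.comp (tendsto_atTop_add_const_right _ _ tendsto_natCast_atTop_atTop)).sub
      (hf.comp tendsto_natCast_atTop_atTop)
  rw [sub_self] at h2
  exact tendsto_nhds_unique h1 (h2.congr fun n => (h n).symm)

theorem IsGlobalSolution.isFixedPoint_of_tendsto {a : ℕ → ℝ → ℝ} {abar : ℕ → ℝ}
    (ha : IsGlobalSolution a) (hlim : ∀ n : ℕ, 1 ≤ n → Tendsto (a n) atTop (𝓝 (abar n))) :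
    IsFixedPoint abar := by
  intro n hn
  refine derivative_limit_eq_zero (ha.equation n hn) (hlim n hn) ?_
  -- The case n = 1 is separate because nothing is assumed about the limit of coordinate 0.
  rcases hn.eq_or_lt with rfl | h
  · simpa [field_one] using (hlim 2 (by norm_num)).neg
  · exact ((hlim (n - 1) (by omega)).const_mul _).sub ((hlim (n + 1) (by omega)).const_mul _)

theorem tendsto_artanh_neg : Tendsto (fun x : ℝ => Real.artanh (-x)) (𝓝[>] (-1)) atTop := by
  refine tendsto_atTop.2 fun b => ?_
  have h : -1 < -Real.tanh b := neg_lt_neg (Real.tanh_lt_one b)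
  filter_upwards [Ioo_mem_nhdsGT h] with x hx
  calc b = Real.artanh (Real.tanh b) := (Real.artanh_tanh b).symm
    _ ≤ Real.artanh (-x) :=
      Real.artanh_le_artanh (Real.neg_one_lt_tanh b) (by linarith [hx.1]) (by linarith [hx.2])

theorem tendsto_mul_sqrt_one_add {a : ℕ → ℝ → ℝ} {l : ℝ} (ha : IsGlobalSolution a)
    (hlim : Tendsto (a 1) atTop (𝓝 l)) {G : ℂ → ℂ}
    (hG : IsGeneratingFunction (fun n => a n 0) G) :
    Tendsto (fun x : ℝ => G x * (√(1 + x) : ℝ)) (𝓝[>] (-1)) (𝓝 ((l / √2 : ℝ) : ℂ)) := by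
  have h1 : Tendsto (fun x : ℝ => a 1 (Real.artanh (-x))) (𝓝[>] (-1)) (𝓝 l) :=
    hlim.comp tendsto_artanh_neg
  have h2 : Tendsto (fun x : ℝ => √(1 - x)) (𝓝[>] (-1)) (𝓝 √2) := by
    have : ContinuousAt (fun x : ℝ => √(1 - x)) (-1) := by fun_prop
    have := this.tendsto.mono_left (nhdsWithin_le_nhds (s := Ioi (-1)))
    norm_num at this
    exact this
  have h3 := (Complex.continuous_ofReal.tendsto _).comp (h1.div h2 (by positivity))
  refine h3.congr' ?_
  filter_upwards [Ioo_mem_nhdsGT (show (-1 : ℝ) < 0 by norm_num)] with x hx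
  have hs : √(1 - x) ≠ 0 := (Real.sqrt_pos.2 (by linarith [hx.2])).ne'
  have hs' : ((√(1 - x) : ℝ) : ℂ) ≠ 0 := by exact_mod_cast hs
  have hG' := hG.mul_sqrt ha ⟨hx.1, hx.2.le⟩
  rw [show 1 - x ^ 2 = (1 + x) * (1 - x) by ring, Real.sqrt_mul (by linarith [hx.1])] at hG'
  simp only [Function.comp, Pi.div_apply]
  push_cast at hG' ⊢
  rw [← hG', ← mul_assoc, mul_div_cancel_right₀ _ hs']

theorem tendsto_one_add_rpow {β : ℝ} (hβ : 0 < β) :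
    Tendsto (fun x : ℝ => (1 + x) ^ β) (𝓝[>] (-1)) (𝓝 0) := by
  have h : ContinuousAt (fun x : ℝ => (1 + x) ^ β) (-1) :=
    (by fun_prop : ContinuousAt (fun x : ℝ => 1 + x) (-1)).rpow_const (Or.inr hβ.le)
  simpa [Real.zero_rpow hβ.ne'] using h.tendsto.mono_left (nhdsWithin_le_nhds (s := Ioi (-1)))

/-- If β > 0 the limit would be 0. If β < 0, multiplying by (1 + x)^(-β) → 0 gives A = 0, hence
again l = 0. -/
theorem eq_of_tendsto_mul_rpow {A β l : ℝ} (hl : l ≠ 0)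
    (h : Tendsto (fun x : ℝ => A * (1 + x) ^ β) (𝓝[>] (-1)) (𝓝 l)) : β = 0 ∧ A = l := by
  rcases lt_trichotomy β 0 with hβ | rfl | hβ
  · exfalso
    have h1 := h.mul (tendsto_one_add_rpow (neg_pos.2 hβ))
    rw [mul_zero] at h1
    have h2 : Tendsto (fun _ : ℝ => A) (𝓝[>] (-1 : ℝ)) (𝓝 0) := by
      refine h1.congr' ?_
      filter_upwards [self_mem_nhdsWithin] with x hx
      have hx' : 0 < 1 + x := by linarith [mem_Ioi.1 hx]
      rw [mul_assoc, ← Real.rpow_add hx', add_neg_cancel, Real.rpow_zero, mul_one]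
    have hA : A = 0 := tendsto_nhds_unique tendsto_const_nhds h2
    simp only [hA, zero_mul] at h
    exact hl (tendsto_nhds_unique h tendsto_const_nhds)
  · simp only [Real.rpow_zero, mul_one] at h
    exact ⟨rfl, tendsto_nhds_unique tendsto_const_nhds h⟩
  · exfalso
    have h1 := (tendsto_one_add_rpow hβ).const_mul A
    rw [mul_zero] at h1
    exact hl (tendsto_nhds_unique h h1)

theorem one_add_cpow_mul_sqrt {x : ℝ} (hx : -1 < x) (A α : ℝ) :
    (A : ℂ) * (1 + (x : ℂ)) ^ (-(α : ℂ)) * (√(1 + x) : ℝ) =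
      ((A * (1 + x) ^ (1 / 2 - α) : ℝ) : ℂ) := by
  have hx' : 0 < 1 + x := by linarith
  have e : (1 + (x : ℂ)) ^ (-(α : ℂ)) = (((1 + x) ^ (-α) : ℝ) : ℂ) := by
    rw [Complex.ofReal_cpow hx'.le]
    push_cast
    rfl
  rw [e, Real.sqrt_eq_rpow, ← Complex.ofReal_mul, ← Complex.ofReal_mul, mul_assoc,
    ← Real.rpow_add hx']
  ring_nf

/-- Multiplication by √(1 + x) sends the remainder, which has a finite limit, to 0. -/
theorem tendsto_of_hasFiniteLimit {G : ℂ → ℂ} {A α l : ℝ}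
    (hG : Tendsto (fun x : ℝ => G x * (√(1 + x) : ℝ)) (𝓝[>] (-1)) (𝓝 (l : ℂ)))
    (h : HasFiniteLimit (fun z => G z - (A : ℂ) * (1 + z) ^ (-(α : ℂ)))) :
    Tendsto (fun x : ℝ => A * (1 + x) ^ (1 / 2 - α)) (𝓝[>] (-1)) (𝓝 l) := by
  obtain ⟨c, hc⟩ := h
  have h0 := (Complex.continuous_ofReal.tendsto _).comp
    (tendsto_one_add_rpow (show (0 : ℝ) < 1 / 2 by norm_num))
  have h1 := hG.sub (hc.mul h0)
  rw [Complex.ofReal_zero, mul_zero, sub_zero] at h1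
  have h2 : Tendsto (fun x : ℝ => ((A * (1 + x) ^ (1 / 2 - α) : ℝ) : ℂ)) (𝓝[>] (-1))
      (𝓝 (l : ℂ)) := by
    refine h1.congr' ?_
    filter_upwards [self_mem_nhdsWithin] with x hx
    rw [← one_add_cpow_mul_sqrt hx]
    simp only [Function.comp, ← Real.sqrt_eq_rpow]
    ring
  exact (Complex.continuous_re.tendsto _).comp h2

theorem tendsto_of_isEquivalent {G : ℂ → ℂ} {A α l : ℝ}
    (hG : Tendsto (fun x : ℝ => G x * (√(1 + x) : ℝ)) (𝓝[>] (-1)) (𝓝 (l : ℂ)))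
    (h : Asymptotics.IsEquivalent (𝓝[>] (-1 : ℝ)) (fun x : ℝ => G (x : ℂ))
      (fun x : ℝ => (A : ℂ) * (1 + (x : ℂ)) ^ (-(α : ℂ)))) :
    Tendsto (fun x : ℝ => A * (1 + x) ^ (1 / 2 - α)) (𝓝[>] (-1)) (𝓝 l) := by
  have h1 := (h.mul (Asymptotics.IsEquivalent.refl
    (u := fun x : ℝ => ((√(1 + x) : ℝ) : ℂ)))).tendsto_nhds hG
  have h2 : Tendsto (fun x : ℝ => ((A * (1 + x) ^ (1 / 2 - α) : ℝ) : ℂ)) (𝓝[>] (-1))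
      (𝓝 (l : ℂ)) := by
    refine h1.congr' ?_
    filter_upwards [self_mem_nhdsWithin] with x hx
    rw [← one_add_cpow_mul_sqrt hx]
    rfl
  exact (Complex.continuous_re.tendsto _).comp h2

theorem one_add_cpow_neg_half (A : ℝ) (z : ℂ) :
    (A : ℂ) * (1 + z) ^ (-((1 / 2 : ℝ) : ℂ)) = (A : ℂ) / (1 + z) ^ (1 / 2 : ℂ) := by
  rw [Complex.cpow_neg, div_eq_mul_inv]
  push_cast
  rfl

theorem analyticOnNhd_one_add_cpow_half (A : ℝ) :
    AnalyticOnNhd ℂ (fun z : ℂ => (A : ℂ) / (1 + z) ^ (1 / 2 : ℂ)) negInterval := by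
  rintro _ ⟨x, hx, rfl⟩
  have hs : 1 + (x : ℂ) ∈ Complex.slitPlane := by
    left
    simp only [Complex.add_re, Complex.one_re, Complex.ofReal_re]
    linarith [hx.1]
  refine AnalyticAt.div (by fun_prop) (AnalyticAt.cpow (by fun_prop) (by fun_prop) hs) ?_
  simp [Complex.cpow_eq_zero_iff, Complex.slitPlane_ne_zero hs]

end ShellModel

theorem mainTheorem6 :
    (∀ (a : ℕ → ℝ → ℝ) (abar : ℕ → ℝ),
      ShellModel.IsGlobalSolution a →
      (∀ n : ℕ, 1 ≤ n → Tendsto (a n) atTop (𝓝 (abar n))) →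
      (∃ n : ℕ, 1 ≤ n ∧ abar n ≠ 0) →
      (∃ G₀ : ℂ → ℂ, ShellModel.IsGeneratingFunction (fun n => a n 0) G₀) ∧
      ∀ G₀ : ℂ → ℂ, ShellModel.IsGeneratingFunction (fun n => a n 0) G₀ →
        (∀ A α : ℝ,
          ShellModel.HasFiniteLimit (fun z => G₀ z - (A : ℂ) * (1 + z) ^ (-(α : ℂ))) →
          A ≠ 0 ∧ α = 1 / 2 ∧
          (∃ Gt : ℂ → ℂ,
            AnalyticOnNhd ℂ Gt ShellModel.negInterval ∧
            ShellModel.HasFiniteLimit Gt ∧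
            ∀ᶠ z in 𝓝ˢ ShellModel.negInterval,
              G₀ z = (A : ℂ) / (1 + z) ^ (1 / 2 : ℂ) + Gt z) ∧
          ShellModel.HasFixedPointForm abar A) ∧
        (∀ A α : ℝ, A ≠ 0 → 0 < α →
          Asymptotics.IsEquivalent (𝓝[>] (-1 : ℝ)) (fun x : ℝ => G₀ (x : ℂ))
            (fun x : ℝ => (A : ℂ) * (1 + (x : ℂ)) ^ (-(α : ℂ))) →
          α = 1 / 2 ∧ ShellModel.HasFixedPointForm abar A)) ∧
    (∀ b : ℕ → ℝ, b 0 = 0 →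
      (ShellModel.IsFixedPoint b ↔ ∃ A : ℝ, ShellModel.HasFixedPointForm b A)) := by
  refine ⟨fun a abar ha hlim hne => ?_, fun b _ => ShellModel.isFixedPoint_iff_exists_form b⟩
  have hfix := (ShellModel.isFixedPoint_iff abar).1 (ha.isFixedPoint_of_tendsto hlim)
  have h1 : abar 1 ≠ 0 := by
    obtain ⟨n, hn, hn0⟩ := hne
    obtain ⟨m, rfl⟩ := Nat.exists_eq_add_of_le' hn
    intro h
    exact hn0 (by rw [hfix m, h, zero_mul])
  have hl : abar 1 / √2 ≠ 0 := div_ne_zero h1 (by positivity)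
  have hform : ShellModel.HasFixedPointForm abar (abar 1 / √2) := by
    rw [ShellModel.hasFixedPointForm_iff, div_mul_cancel₀ _ (by positivity)]
    exact hfix
  obtain ⟨F, hF, -⟩ := ShellModel.exists_generatingFunction ha
  refine ⟨⟨F, hF⟩, fun G₀ hG₀ => ?_⟩
  have hG := ShellModel.tendsto_mul_sqrt_one_add ha (hlim 1 le_rfl) hG₀
  refine ⟨fun A α h => ?_, fun A α _ _ h => ?_⟩
  · obtain ⟨hα, rfl⟩ :=
      ShellModel.eq_of_tendsto_mul_rpow hl (ShellModel.tendsto_of_hasFiniteLimit hG h)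
    obtain rfl : α = 1 / 2 := by linarith
    -- With α = 1/2 known, the regular part is the difference itself, and its finite limit is the
    -- hypothesis.
    refine ⟨hl, rfl, ⟨fun z => G₀ z - ((abar 1 / √2 : ℝ) : ℂ) / (1 + z) ^ (1 / 2 : ℂ),
      hG₀.1.sub (ShellModel.analyticOnNhd_one_add_cpow_half _), ?_, ?_⟩, hform⟩
    · simpa only [ShellModel.one_add_cpow_neg_half] using h
    · exact Eventually.of_forall fun z => by ring
  · obtain ⟨hα, rfl⟩ :=
      ShellModel.eq_of_tendsto_mul_rpow hl (ShellModel.tendsto_of_isEquivalent hG h)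
    exact ⟨by linarith, hform⟩
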